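/- Let $R$ be a ring with identity, not necessarily commutative. Let $U(R)$ be its group of units, $J(R)$ its Jacobson radical, and let $\Delta(R)=\{r\in R : r+u\in U(R)\text{ for all }u\in U(R)\}$. Suppose that $R$ is an exchange ring, i.e. for every $a\in R$ there is an idempotent $e\in aR$ such that $1-e\in(1-a)R$. Then the following two statements are equivalent: (1) $R$ is a $W\Delta U$-ring, i.e. $U(R)=\pm 1+\Delta(R)$; (2) $R$ is a $WUJ$-ring, i.e. $U(R)=\pm 1+J(R)$. Here, for a subset $S\subseteq R$, $\pm 1+S$ denotes the set $(1+S)\cup(-1+S)$. -/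

import Mathlib

namespace UnitRings

/-- The set `Δ(R) = {r ∈ R : r + U(R) ⊆ U(R)}` of a (not necessarily commutative) ring with
identity. -/
def delta (R : Type*) [Ring R] : Set R :=
  {r | ∀ u : R, IsUnit u → IsUnit (r + u)}

/-- The set `± 1 + S`, that is, the union of `1 + S` and `-1 + S`. -/
def pmOneAdd {R : Type*} [Ring R] (S : Set R) : Set R :=
  {x | ∃ d ∈ S, x = 1 + d ∨ x = -1 + d}

/-- `R` is weakly `ΔU`: `U(R) = ± 1 + Δ(R)`. -/
def IsWDeltaU (R : Type*) [Ring R] : Prop :=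
  {u : R | IsUnit u} = pmOneAdd (delta R)

/-- `R` is weakly `UJ` (also called weakly `JU`): `U(R) = ± 1 + J(R)`, with `J(R)` the Jacobson
radical. -/
def IsWUJ (R : Type*) [Ring R] : Prop :=
  {u : R | IsUnit u} = pmOneAdd (Ring.jacobson R : Set R)

/-- `R` is an exchange ring: for every `a` there is an idempotent `e ∈ aR` with
`1 - e ∈ (1 - a)R`. -/
def IsExchange (R : Type*) [Ring R] : Prop :=
  ∀ a : R, ∃ e : R, IsIdempotentElem e ∧ (∃ x : R, e = a * x) ∧ ∃ y : R, 1 - e = (1 - a) * y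

end UnitRings

namespace UnitRings

section

variable {R : Type*} [Ring R]

/-! It suffices that `Δ(R) = J(R)` when `R` is exchange and WΔU; `J ⊆ Δ` always holds. By exchange,
`r ∈ J` as soon as `rR` contains no nonzero idempotent. WΔU puts square-zero elements in `Δ`
(`IsExchange.sq_zero_mem_delta`), hence also the off-diagonal Peirce corners of any idempotent, and
makes `R` Dedekind finite. For `r ∈ Δ` and an idempotent `e = r * b`, these facts force `e = 0`
(`eq_zero_of_mem_delta_of_eq_mul`). -/

theorem isUnit_one_sub_swap {a b : R} (h : IsUnit (1 - a * b)) : IsUnit (1 - b * a) := by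
  obtain ⟨⟨u, v, huv, hvu⟩, rfl : u = 1 - a * b⟩ := h
  refine ⟨⟨1 - b * a, 1 + b * v * a, ?_, ?_⟩, rfl⟩
  · calc (1 - b * a) * (1 + b * v * a) = 1 - b * a + b * ((1 - a * b) * v) * a := by noncomm_ring
      _ = 1 := by rw [huv]; noncomm_ring
  · calc (1 + b * v * a) * (1 - b * a) = 1 - b * a + b * (v * (1 - a * b)) * a := by noncomm_ring
      _ = 1 := by rw [hvu]; noncomm_ring

theorem mem_jacobson_of_right_inverse {r : R} (h : ∀ a : R, ∃ v, (1 - r * a) * v = 1) :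
    r ∈ Ring.jacobson R := by
  rw [← Ideal.jacobson_bot, Ideal.mem_jacobson_iff]
  intro y
  have hu : IsUnit (1 - r * -y) := by
    obtain ⟨v, hv⟩ := h (-y)
    obtain ⟨w, hw⟩ := h (y * v)
    -- The right inverse `v` again has the form `1 - r * a`, so it is right invertible too, hence a
    -- unit.
    have hv' : v = 1 - r * (y * v) := by
      calc v = (1 - r * -y) * v - r * (y * v) := by noncomm_ring
        _ = _ := by rw [hv]
    rw [← hv'] at hw
    exact ⟨⟨_, v, hv, (left_inv_eq_right_inv hv hw) ▸ hw⟩, rfl⟩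
  obtain ⟨z, hz⟩ := (isUnit_one_sub_swap hu).exists_left_inv
  refine ⟨z, ?_⟩
  rw [Ideal.mem_bot, ← hz]
  noncomm_ring

theorem jacobson_subset_delta {r : R} (hr : r ∈ Ring.jacobson R) : r ∈ delta R := by
  rintro _ ⟨u, rfl⟩
  rw [← Ideal.jacobson_bot, Ideal.mem_jacobson_iff] at hr
  obtain ⟨z, hz⟩ := hr (↑u⁻¹)
  rw [Ideal.mem_bot] at hz
  obtain ⟨w, hw⟩ := hr (-(z * ↑u⁻¹))
  rw [Ideal.mem_bot] at hw
  set j : R := ↑u⁻¹ * r with hj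
  have h1 : z * (1 + j) = 1 := by
    rw [← sub_eq_zero, ← hz, hj]
    noncomm_ring
  have h2 : w * z = 1 := by
    have hz' : z = 1 - z * j := by rw [← h1]; noncomm_ring
    calc w * z = w * (1 - z * j) := by rw [← hz']
      _ = (w * -(z * ↑u⁻¹) * r + w - 1) + 1 := by rw [hj]; noncomm_ring
      _ = 1 := by rw [hw, zero_add]
  have h3 : (1 + j) * z = 1 := by rw [← left_inv_eq_right_inv h2 h1]; exact h2
  have h4 : IsUnit (1 + j) := ⟨⟨_, z, h3, h1⟩, rfl⟩
  have h5 : r + u = u * (1 + j) := by rw [mul_add, hj, Units.mul_inv_cancel_left]; noncomm_ring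
  rw [h5]
  exact u.isUnit.mul h4

theorem add_mem_delta {r s : R} (hr : r ∈ delta R) (hs : s ∈ delta R) : r + s ∈ delta R := by
  intro u hu
  rw [add_assoc]
  exact hr _ (hs _ hu)

theorem neg_mem_delta {r : R} (hr : r ∈ delta R) : -r ∈ delta R := by
  intro u hu
  simpa [add_comm] using (hr _ hu.neg).neg

theorem sub_mem_delta {r s : R} (hr : r ∈ delta R) (hs : s ∈ delta R) : r - s ∈ delta R :=
  sub_eq_add_neg r s ▸ add_mem_delta hr (neg_mem_delta hs)

theorem mul_unit_mem_delta {r u : R} (hr : r ∈ delta R) (hu : IsUnit u) : r * u ∈ delta R := by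
  obtain ⟨u, rfl⟩ := hu
  intro v hv
  have h : r * u + v = (r + v * ↑u⁻¹) * u := by rw [add_mul, Units.inv_mul_cancel_right]
  rw [h]
  exact (hr _ (hv.mul u⁻¹.isUnit)).mul u.isUnit

theorem mul_mem_delta {r s : R} (hr : r ∈ delta R) (hs : s ∈ delta R) : r * s ∈ delta R := by
  -- `s + 1` is a unit, and `Δ` absorbs units.
  have h : r * s = r * (s + 1) - r := by noncomm_ring
  rw [h]
  exact sub_mem_delta (mul_unit_mem_delta hr (hs 1 isUnit_one)) hr

theorem isUnit_one_sub_of_mem_delta {r : R} (hr : r ∈ delta R) : IsUnit (1 - r) := by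
  simpa [add_comm, sub_eq_add_neg] using neg_mem_delta hr 1 isUnit_one

theorem eq_zero_of_isIdempotentElem_of_mem_delta {e : R} (he : IsIdempotentElem e)
    (hd : e ∈ delta R) : e = 0 := by
  refine (isUnit_one_sub_of_mem_delta hd).mul_left_eq_zero.1 ?_
  rw [mul_sub, mul_one, he.eq, sub_self]

/-- In an exchange ring, an element that divides no nonzero idempotent on the left lies in the
Jacobson radical. -/
theorem IsExchange.mem_jacobson (hR : IsExchange R) {r : R}
    (h : ∀ e b : R, IsIdempotentElem e → e = r * b → e = 0) : r ∈ Ring.jacobson R := by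
  refine mem_jacobson_of_right_inverse fun a => ?_
  obtain ⟨e, he, ⟨x, hx⟩, y, hy⟩ := hR (r * a)
  rw [h e (a * x) he (by rw [hx, mul_assoc]), sub_zero] at hy
  exact ⟨y, hy.symm⟩

/-- Since 4 is central, `e * b * e` inverts it in `eRe`. Extended by `1 - e` this is a unit `u` with
`4 * u ∈ Δ`, and `e` kills the unit `1 - 4 * u`. -/
theorem eq_zero_of_four_mem_delta (h4 : (4 : R) ∈ delta R) {e b : R} (he : IsIdempotentElem e)
    (hb : e = 4 * b) : e = 0 := by
  have c4 : ∀ x : R, x * 4 = 4 * x := fun x => by noncomm_ring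
  have hebe : 4 * (e * b * e) = e := by
    calc 4 * (e * b * e) = e * (4 * b) * e := by noncomm_ring
      _ = e := by rw [← hb, he.eq, he.eq]
  have h1 : e * (1 - e) = 0 := by rw [mul_sub, mul_one, he.eq, sub_self]
  have h2 : (1 - e) * e = 0 := by rw [sub_mul, one_mul, he.eq, sub_self]
  have h3 : (1 - e) * (1 - e) = 1 - e := he.one_sub.eq
  have hu : IsUnit (e * b * e + (1 - e)) := by
    refine ⟨⟨_, 4 * e + (1 - e), ?_, ?_⟩, rfl⟩
    · calc (e * b * e + (1 - e)) * (4 * e + (1 - e))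
          = 4 * (e * b * (e * e)) + e * b * (e * (1 - e)) + 4 * ((1 - e) * e)
            + (1 - e) * (1 - e) := by noncomm_ring
        _ = 1 := by rw [he.eq, h1, h2, h3, hebe]; noncomm_ring
    · calc (4 * e + (1 - e)) * (e * b * e + (1 - e))
          = 4 * ((e * e) * b * e) + 4 * (e * (1 - e)) + ((1 - e) * e) * b * e
            + (1 - e) * (1 - e) := by noncomm_ring
        _ = 1 := by rw [he.eq, h1, h2, h3, hebe]; noncomm_ring
  refine (isUnit_one_sub_of_mem_delta (mul_unit_mem_delta h4 hu)).mul_left_eq_zero.1 ?_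
  calc e * (1 - 4 * (e * b * e + (1 - e)))
      = e - e * (4 * (e * b * e)) - 4 * (e * (1 - e)) := by noncomm_ring
    _ = 0 := by rw [hebe, he.eq, h1]; simp

theorem IsExchange.two_mem_delta (hR : IsExchange R) (h4 : (4 : R) ∈ delta R) :
    (2 : R) ∈ delta R := by
  refine jacobson_subset_delta (mem_jacobson_of_right_inverse fun a => ?_)
  -- `1 - 4a² = (1 - 2a)(1 + 2a)`, so a right inverse of it yields one of `1 - 2a`.
  obtain ⟨e, he, ⟨x, hx⟩, y, hy⟩ := hR (4 * (a * a))
  rw [eq_zero_of_four_mem_delta h4 he (by rw [hx, mul_assoc]), sub_zero] at hy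
  refine ⟨(1 + 2 * a) * y, ?_⟩
  calc (1 - 2 * a) * ((1 + 2 * a) * y) = (1 - 4 * (a * a)) * y := by noncomm_ring
    _ = 1 := hy.symm

theorem IsExchange.sq_zero_mem_delta (hR : IsExchange R) (hW : IsWDeltaU R) {n : R}
    (hn : n * n = 0) : n ∈ delta R := by
  have key : ∀ m : R, m * m = 0 → m ∈ delta R ∨ 2 + m ∈ delta R := by
    intro m hm
    have hu : IsUnit (1 + m) := by
      refine ⟨⟨1 + m, 1 - m, ?_, ?_⟩, rfl⟩
      · calc (1 + m) * (1 - m) = 1 - m * m := by noncomm_ring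
          _ = 1 := by rw [hm, sub_zero]
      · calc (1 - m) * (1 + m) = 1 - m * m := by noncomm_ring
          _ = 1 := by rw [hm, sub_zero]
    obtain ⟨d, hd, h | h⟩ : 1 + m ∈ pmOneAdd (delta R) := hW ▸ hu
    · exact Or.inl (add_left_cancel h ▸ hd)
    · refine Or.inr ?_
      have h' : 2 + m = d := by
        calc 2 + m = 1 + (1 + m) := by rw [← add_assoc, one_add_one_eq_two]
          _ = d := by rw [h, add_neg_cancel_left]
      exact h' ▸ hd
  rcases key n hn with h | h
  -- In the remaining bad case, `2 + n` and `2 - n` both lie in `Δ`, and so does their sum 4.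
  · exact h
  rcases key (-n) (by simpa using hn) with h' | h'
  · simpa using neg_mem_delta h'
  have h4 : (4 : R) ∈ delta R := by
    have h4' : (4 : R) = (2 + n) + (2 + -n) := by
      rw [add_add_add_comm, add_neg_cancel, add_zero]; norm_num
    rw [h4']
    exact add_mem_delta h h'
  simpa using sub_mem_delta h (hR.two_mem_delta h4)

/-- A ring whose square-zero elements lie in `Δ(R)` is Dedekind finite. -/
theorem mul_eq_one_symm_of_sq_zero (hN : ∀ n : R, n * n = 0 → n ∈ delta R) {x y : R}
    (h : x * y = 1) : y * x = 1 := by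
  have hi : IsIdempotentElem (y * x) := by
    calc y * x * (y * x) = y * (x * y) * x := by noncomm_ring
      _ = y * x := by rw [h, mul_one]
  have hx : (1 - y * x) * x ∈ delta R := by
    apply hN
    calc (1 - y * x) * x * ((1 - y * x) * x)
        = (1 - y * x) * (x - (x * y) * x) * x := by noncomm_ring
      _ = 0 := by rw [h]; simp
  have hy : y * (1 - y * x) ∈ delta R := by
    apply hN
    calc y * (1 - y * x) * (y * (1 - y * x))
        = y * (y - y * (x * y)) * (1 - y * x) := by noncomm_ring
      _ = 0 := by rw [h]; simp
  -- The idempotent `1 - y * x` is a product of two square-zero elements.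
  have hd : 1 - y * x ∈ delta R := by
    have h' : (1 - y * x) * x * (y * (1 - y * x)) = 1 - y * x := by
      calc _ = (1 - y * x) * (x * y) * (1 - y * x) := by noncomm_ring
        _ = 1 - y * x := by rw [h, mul_one, hi.one_sub.eq]
    exact h' ▸ mul_mem_delta hx hy
  exact (sub_eq_zero.1 (eq_zero_of_isIdempotentElem_of_mem_delta hi.one_sub hd)).symm

/-- Dropping its off-diagonal corners keeps `r` in `Δ`. As `e = r * b`, the element `p = e * r * e +
(1 - e)` is invertible up to a corner product in `Δ`, so it is a unit. Subtracting `p` from the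
diagonal part of `r` leaves a unit that `e` kills. -/
theorem eq_zero_of_mem_delta_of_eq_mul (hN : ∀ n : R, n * n = 0 → n ∈ delta R) {r e b : R}
    (hr : r ∈ delta R) (he : IsIdempotentElem e) (hb : e = r * b) : e = 0 := by
  have h1 : e * (1 - e) = 0 := by rw [mul_sub, mul_one, he.eq, sub_self]
  have h2 : (1 - e) * e = 0 := by rw [sub_mul, one_mul, he.eq, sub_self]
  have h3 : (1 - e) * (1 - e) = 1 - e := he.one_sub.eq
  have hl : ∀ x : R, e * x * (1 - e) ∈ delta R := fun x => hN _ <| by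
    calc e * x * (1 - e) * (e * x * (1 - e)) = e * x * ((1 - e) * e) * x * (1 - e) := by
          noncomm_ring
      _ = 0 := by rw [h2]; simp
  have hr' : ∀ x : R, (1 - e) * x * e ∈ delta R := fun x => hN _ <| by
    calc (1 - e) * x * e * ((1 - e) * x * e) = (1 - e) * x * (e * (1 - e)) * x * e := by
          noncomm_ring
      _ = 0 := by rw [h1]; simp
  have ht : r - e * r * (1 - e) - (1 - e) * r * e ∈ delta R :=
    sub_mem_delta (sub_mem_delta hr (hl r)) (hr' r)
  have hs := isUnit_one_sub_of_mem_delta (mul_mem_delta (hl r) (hr' b))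
  have hpq : (e * r * e + (1 - e)) * (e * b * e + (1 - e))
      = 1 - e * r * (1 - e) * ((1 - e) * b * e) := by
    calc (e * r * e + (1 - e)) * (e * b * e + (1 - e))
        = e * r * (e * e) * b * e + e * r * (e * (1 - e)) + ((1 - e) * e) * b * e
          + (1 - e) * (1 - e) := by noncomm_ring
      _ = 1 - e + e * (r * b) * e - e * r * (1 - e) * b * e := by
          rw [h1, h2, h3, he.eq]; noncomm_ring
      _ = 1 - e * r * ((1 - e) * (1 - e)) * b * e := by
          rw [← hb, he.eq, he.eq, h3]; noncomm_ring
      _ = _ := by noncomm_ring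
  rw [← hpq] at hs
  obtain ⟨v, hv⟩ := hs.exists_right_inv
  rw [mul_assoc] at hv
  have hp : IsUnit (e * r * e + (1 - e)) := ⟨⟨_, _, hv, mul_eq_one_symm_of_sq_zero hN hv⟩, rfl⟩
  refine (ht _ hp.neg).mul_left_eq_zero.1 ?_
  calc e * (r - e * r * (1 - e) - (1 - e) * r * e + -(e * r * e + (1 - e)))
      = e * r - (e * e) * r * (1 - e) - (e * (1 - e)) * r * e - (e * e) * r * e
        - e * (1 - e) := by noncomm_ring
    _ = 0 := by rw [h1, he.eq]; noncomm_ring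

theorem IsExchange.delta_eq_jacobson (hR : IsExchange R) (hW : IsWDeltaU R) :
    delta R = (Ring.jacobson R : Set R) :=
  Set.Subset.antisymm
    (fun _ hr => hR.mem_jacobson fun _ _ he hb =>
      eq_zero_of_mem_delta_of_eq_mul (fun _ hn => hR.sq_zero_mem_delta hW hn) hr he hb)
    (fun _ hr => jacobson_subset_delta hr)

theorem IsWUJ.isWDeltaU (h : IsWUJ R) : IsWDeltaU R := by
  refine Set.Subset.antisymm (fun u hu => ?_) ?_
  · obtain ⟨d, hd, hud⟩ : u ∈ pmOneAdd (Ring.jacobson R : Set R) := h ▸ hu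
    exact ⟨d, jacobson_subset_delta hd, hud⟩
  · rintro _ ⟨d, hd, rfl | rfl⟩
    · exact add_comm d 1 ▸ hd 1 isUnit_one
    · exact add_comm d (-1) ▸ hd (-1) isUnit_one.neg

end

end UnitRings

theorem mainTheorem3 (R : Type*) [Ring R] (hR : UnitRings.IsExchange R) :
    UnitRings.IsWDeltaU R ↔ UnitRings.IsWUJ R := by
  refine ⟨fun h => ?_, UnitRings.IsWUJ.isWDeltaU⟩
  rw [UnitRings.IsWUJ, ← hR.delta_eq_jacobson h]
  exact h
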